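/- Let $f\in\mathbb R[x,y]$ be regular in $x$, i.e. $f_m(1,0)\neq 0$, where $f_m$ is the nonzero homogeneous part of $f$ of lowest degree $m$. A Puiseux series is a series $\varphi(y)=\sum_{\alpha} c_\alpha y^{\alpha}$ with $c_\alpha\in\mathbb C$ whose exponents lie in $\{n/N : n\in\mathbb N,\ n\ge N\}$ for some positive integer $N$ ($\varphi=0$ is allowed); it is real if all $c_\alpha$ are real. Let $\mathcal V(f)$ be the set of Newton–Puiseux roots of $f$, i.e. of the Puiseux series $\gamma$ with $f(\gamma(y),y)=0$. The order $\mathrm{ord}$ of a series is its least exponent, $\mathrm{ord}\,0=\infty$. Let $\gamma=\sum_\alpha c_\alpha y^\alpha\in\mathcal V(f)$, and suppose that $\mathcal V(f)$ contains a series other than $\gamma$. Then the contact order $$\rho=\rho(\gamma,f):=\max\{\mathrm{ord}(\gamma-\gamma') : \gamma'\in\mathcal V(f),\ \gamma'\ne\gamma\}$$ exists. Let $\tilde\gamma:=\sum_{\alpha\le\rho}c_\alpha y^\alpha$ be the truncated Newton–Puiseux root, and for $c\in\mathbb R$ let $\tilde\gamma_{\rho,c}:=\sum_{\alpha<\rho}c_\alpha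 y^\alpha+c\,y^\rho$. The following hold. (i) If $\tilde\gamma$ is real, then $\gamma$ is real. (ii) Write $f(X+\tilde\gamma(Y),Y)=\sum c_{ij}X^iY^{j/N}$. Let $\mathrm{mult}_\gamma f$ be the multiplicity of $\gamma$ as a root of $f$, i.e. the largest $k$ such that $(x-\gamma(y))^k$ divides $f(x,y)$ as a polynomial in $x$. Then for generic $c$, i.e. for all but finitely many $c\in\mathbb R$, $$\mathrm{mult}_\gamma f=\min\{\,i : \text{there is } j \text{ with } c_{ij}\neq 0 \text{ and } i\rho+j/N=\mathrm{ord}\, f(\tilde\gamma_{\rho,c}(y),y)\,\}.$$ (iii) Let $g\in\mathbb R[x,y]$ be regular in $x$ and let $h=\gcd(f,g)$ in $\mathbb R[x,y]$. If $\tilde\gamma$ is a Newton–Puiseux root $\mathrm{mod}\ \rho+$ of $h$, i.e. if there is $\xi\in\mathcal V(h)$ with $\mathrm{ord}(\tilde\gamma-\xi)>\rho$, then $\gamma$ is also a Newton–Puiseux root of $g$. -/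

import Mathlib

/-- A complex Puiseux series at the origin, `c₁ y^(n₁/N) + c₂ y^(n₂/N) + ⋯` with integers
`N ≤ n₁ < n₂ < ⋯`, as a Hahn series in `y` with rational exponents. The zero series is allowed. -/
def IsPuiseux (φ : HahnSeries ℚ ℂ) : Prop :=
  ∃ N : ℕ, 0 < N ∧ ∀ α ∈ φ.support, ∃ n : ℕ, N ≤ n ∧ α = (n : ℚ) / (N : ℚ)

/-- The series is real: all its coefficients are real. -/
def IsRealSeries (φ : HahnSeries ℚ ℂ) : Prop :=
  ∀ α : ℚ, (φ.coeff α).im = 0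

/-- The monomial `c y^α`. -/
noncomputable def yMonomial (α : ℚ) (c : ℂ) : HahnSeries ℚ ℂ :=
  HahnSeries.single α c

/-- `f(φ(y), y)`, where the variables of `f` are `x = X 0` and `y = X 1`. -/
noncomputable def evalAlong (f : MvPolynomial (Fin 2) ℝ) (φ : HahnSeries ℚ ℂ) :
    HahnSeries ℚ ℂ :=
  MvPolynomial.aeval ![φ, yMonomial 1 1] f

/-- `F(X, Y) = f(X + φ(Y), Y)`, as a polynomial in `X` over the series in `Y`. -/
noncomputable def expandAlong (f : MvPolynomial (Fin 2) ℝ) (φ : HahnSeries ℚ ℂ) :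
    Polynomial (HahnSeries ℚ ℂ) :=
  MvPolynomial.aeval
    ![Polynomial.X + Polynomial.C φ, Polynomial.C (yMonomial 1 1)] f

/-- The coefficient of `X^i Y^q` in `f(X + φ(Y), Y)`. -/
noncomputable def newtonCoeff (f : MvPolynomial (Fin 2) ℝ) (φ : HahnSeries ℚ ℂ)
    (i : ℕ) (q : ℚ) : ℂ :=
  ((expandAlong f φ).coeff i).coeff q

/-- `f` is regular in `x`: its lowest nonzero homogeneous part `f_m` has `f_m(1, 0) ≠ 0`. -/
def XRegular (f : MvPolynomial (Fin 2) ℝ) : Prop :=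
  ∃ m : ℕ, (∀ k < m, MvPolynomial.homogeneousComponent k f = 0) ∧
    MvPolynomial.eval ![1, 0] (MvPolynomial.homogeneousComponent m f) ≠ 0

/-- The set of Newton–Puiseux roots `x = γ(y)` of `f`. -/
def newtonPuiseuxRoots (f : MvPolynomial (Fin 2) ℝ) : Set (HahnSeries ℚ ℂ) :=
  {γ | IsPuiseux γ ∧ evalAlong f γ = 0}

/-- The multiplicity of `γ` as a root of `f`: the largest `m` such that `(x - γ(y))^m` divides
`f(x, y)` as a polynomial in `x`. -/
noncomputable def rootMult (f : MvPolynomial (Fin 2) ℝ) (γ : HahnSeries ℚ ℂ) : ℕ :=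
  (expandAlong f 0).rootMultiplicity γ

/-- `ρ` is the contact order of `φ` and `f`: the maximum of `ord (φ - γ)` over the
Newton–Puiseux roots `γ ≠ φ` of `f`. -/
def IsContactOrder (φ : HahnSeries ℚ ℂ) (f : MvPolynomial (Fin 2) ℝ) (ρ : ℚ) : Prop :=
  IsGreatest {r : ℚ | ∃ γ ∈ newtonPuiseuxRoots f, γ ≠ φ ∧ (φ - γ).orderTop = (r : WithTop ℚ)} ρ

/-- `φ` is a Newton–Puiseux root mod `q+` of `f`. Here `orderTop 0 = ⊤`. -/
def IsRootMod (φ : HahnSeries ℚ ℂ) (q : ℚ) (f : MvPolynomial (Fin 2) ℝ) : Prop :=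
  ∃ γ ∈ newtonPuiseuxRoots f, (q : WithTop ℚ) < (φ - γ).orderTop

/-- The truncation `∑_{α ≤ ρ} c_α y^α`. With `ρ` the contact order of a Newton–Puiseux root `φ`
of `f`, this is the truncated Newton–Puiseux root. -/
def truncLE (ρ : ℚ) (φ : HahnSeries ℚ ℂ) : HahnSeries ℚ ℂ where
  coeff α := if α ≤ ρ then φ.coeff α else 0
  isPWO_support' := φ.isPWO_support.mono fun _ h hα => h (by simp [hα])

/-- The `ρ`-approximation `∑_{α < ρ} c_α y^α + c y^ρ` with parameter `c`. -/
noncomputable def rhoApprox (ρ : ℚ) (c : ℝ) (φ : HahnSeries ℚ ℂ) : HahnSeries ℚ ℂ :=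
  HahnSeries.truncLT ρ φ + yMonomial ρ (c : ℂ)

/-- `h` is a greatest common divisor of `f` and `g` in `ℝ[x, y]`. -/
def IsGCDOf (h f g : MvPolynomial (Fin 2) ℝ) : Prop :=
  h ∣ f ∧ h ∣ g ∧ ∀ d : MvPolynomial (Fin 2) ℝ, d ∣ f → d ∣ g → d ∣ h

/-!
The three claims rest on one fact, `IsContactOrder.eq_of_coeff_eq`: since `ρ` is the largest contact
of `γ` with another root, a Newton–Puiseux root that agrees with `γ` up to `y ^ ρ` is `γ`.

For (i) it is applied to the complex conjugate of `γ`, a root because `f` is real. For (iii) it is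
applied to the root `ξ` of `h`, which is a root of `f` and then also of `g`. The contact order exists
because `f` has finitely many roots (`exists_isContactOrder`).

For (ii), write `f(X + γ) = X ^ k G(X)` with `k = mult_γ f` and `G(0) ≠ 0`, and rescale
`X = y ^ ρ Z`, so that `G(y ^ ρ Z) = y ^ d G'(Z)` where `G'` has a nonzero reduction modulo positive
powers of `y`. This reduction does not vanish at `0`: otherwise the Newton–Puiseux theorem
(`exists_root_residue_eq_zero`) gives a root `z` of `G'` of positive order, and `γ + y ^ ρ z` is a root
of `f` that differs from `γ` and agrees with it up to `y ^ ρ`. Hence the initial form of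
`f(X + γ(Y), Y)` for the weights `(ρ, 1)` vanishes at `0` to the order exactly `k`. Passing from `γ` to
its truncation moves `Z` by a series of positive order and does not change the initial form
(`exists_initialForm_at_truncation`). For all `c` at which the initial form does not vanish after
the shift by the coefficient of `y ^ ρ` in `γ`, its weight is the order of `f` along the
`ρ`-approximation, so that the minimum in (ii) is the order of the initial form at `0`.

The Newton–Puiseux theorem is proved over the ring `puiseuxRing` of Puiseux series with non-negative
exponents, by induction on the order `n` at `0` of the reduced polynomial. Hensel's lemma, applied to
the Hasse derivative of order `n - 1`, yields a translation that removes the term of degree `n - 1`.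
After rescaling along the steepest edge of the Newton polygon, the reduced polynomial has degree `n`,
no term of degree `n - 1`, and is not a monomial, so that it has a root of multiplicity less
than `n`. Hensel's lemma itself comes from the adic completeness of formal power series in
`y ^ (1 / N)`.
-/

/-! ### Puiseux series with non-negative exponents -/

/-- The ramified embedding `p(t) ↦ p(y^(1/N))` of formal power series into Hahn series. -/
noncomputable def ramify (N : ℕ) (hN : 0 < N) : PowerSeries ℂ →+* HahnSeries ℚ ℂ :=
  (HahnSeries.embDomainRingHom
    ((AddMonoidHom.mulRight ((N : ℚ)⁻¹)).comp (Nat.castAddMonoidHom ℚ))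
    (fun a b h => by
      have : (N : ℚ) ≠ 0 := by positivity
      simpa [this] using h)
    (fun a b => by
      have : (0 : ℚ) < (N : ℚ)⁻¹ := by positivity
      simp [mul_le_mul_iff_left₀ this])).comp
    (HahnSeries.toPowerSeries.symm : PowerSeries ℂ ≃+* HahnSeries ℕ ℂ).toRingHom

theorem ramify_coeff (N : ℕ) (hN : 0 < N) (p : PowerSeries ℂ) (n : ℕ) :
    (ramify N hN p).coeff (n / N) = PowerSeries.coeff n p := by
  rw [div_eq_mul_inv]
  simp only [ramify, RingHom.comp_apply]
  refine (HahnSeries.embDomain_coeff (a := n)).trans ?_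
  exact HahnSeries.coeff_toPowerSeries_symm

theorem ramify_coeff_of_forall_ne (N : ℕ) (hN : 0 < N) (p : PowerSeries ℂ) (α : ℚ)
    (h : ∀ n : ℕ, α ≠ n / N) : (ramify N hN p).coeff α = 0 := by
  simp only [ramify, RingHom.comp_apply]
  apply HahnSeries.embDomain_of_notMem_range
  rintro ⟨n, rfl⟩
  exact h n (by simp [div_eq_mul_inv])

theorem ramify_coeff_zero (N : ℕ) (hN : 0 < N) (p : PowerSeries ℂ) :
    (ramify N hN p).coeff 0 = PowerSeries.constantCoeff p := by
  have := ramify_coeff N hN p 0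
  simpa using this

theorem mem_range_ramify_iff {N : ℕ} (hN : 0 < N) {φ : HahnSeries ℚ ℂ} :
    φ ∈ (ramify N hN).range ↔ ∀ α, φ.coeff α ≠ 0 → ∃ n : ℕ, α = n / N := by
  constructor
  · rintro ⟨p, rfl⟩ α hα
    by_contra! h
    exact hα (ramify_coeff_of_forall_ne N hN p α h)
  · intro h
    refine ⟨PowerSeries.mk fun n => φ.coeff (n / N), ?_⟩
    ext α
    by_cases hα : ∃ n : ℕ, α = n / N
    · obtain ⟨n, rfl⟩ := hα
      simp [ramify_coeff]
    · push Not at hα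
      rw [ramify_coeff_of_forall_ne N hN _ α hα]
      by_contra h0
      obtain ⟨n, hn⟩ := h α (Ne.symm h0)
      exact hα n hn

theorem range_ramify_le_mul {N M : ℕ} (hN : 0 < N) (hM : 0 < M) :
    (ramify N hN).range ≤ (ramify (N * M) (Nat.mul_pos hN hM)).range := by
  intro φ hφ
  rw [mem_range_ramify_iff] at hφ ⊢
  intro α hα
  obtain ⟨n, rfl⟩ := hφ α hα
  refine ⟨n * M, ?_⟩
  have : (N : ℚ) ≠ 0 := by positivity
  have : (M : ℚ) ≠ 0 := by positivity
  push_cast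
  field_simp

/-- Being a power series in `y^(1/N)` for some `N`. -/
def IsRamified (φ : HahnSeries ℚ ℂ) : Prop :=
  ∃ (N : ℕ) (hN : 0 < N), φ ∈ (ramify N hN).range

theorem IsRamified.exists_common {φ ψ : HahnSeries ℚ ℂ} (hφ : IsRamified φ) (hψ : IsRamified ψ) :
    ∃ (N : ℕ) (hN : 0 < N), φ ∈ (ramify N hN).range ∧ ψ ∈ (ramify N hN).range := by
  obtain ⟨N, hN, h⟩ := hφ
  obtain ⟨M, hM, h'⟩ := hψ
  refine ⟨N * M, Nat.mul_pos hN hM, range_ramify_le_mul hN hM h, ?_⟩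
  have := range_ramify_le_mul hM hN h'
  simpa only [mul_comm M N] using this

theorem isRamified_single {r : ℚ} (hr : 0 ≤ r) (c : ℂ) : IsRamified (HahnSeries.single r c) := by
  refine ⟨r.den, r.den_pos, (mem_range_ramify_iff _).2 fun α hα => ?_⟩
  have : α = r := by
    by_contra h
    exact hα (HahnSeries.coeff_single_of_ne h)
  refine ⟨r.num.toNat, ?_⟩
  have h : ((r.num.toNat : ℤ) : ℚ) = r.num := by
    rw [Int.toNat_of_nonneg (Rat.num_nonneg.2 hr)]
  rw [this]
  calc r = r.num / r.den := (Rat.num_div_den r).symm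
    _ = _ := by rw [← h, Int.cast_natCast]

theorem algebraMap_hahnSeries_eq (c : ℝ) :
    algebraMap ℝ (HahnSeries ℚ ℂ) c = HahnSeries.single 0 (c : ℂ) := by
  rw [HahnSeries.algebraMap_apply']
  simp [HahnSeries.C_apply, PowerSeries.algebraMap_apply]

/-- The ring of Puiseux series with exponents in `{n / N : n ∈ ℕ}` for some `N`. -/
noncomputable def puiseuxRing : Subalgebra ℝ (HahnSeries ℚ ℂ) where
  carrier := {φ | IsRamified φ}
  mul_mem' ha hb := by
    obtain ⟨N, hN, h, h'⟩ := IsRamified.exists_common ha hb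
    exact ⟨N, hN, mul_mem h h'⟩
  add_mem' ha hb := by
    obtain ⟨N, hN, h, h'⟩ := IsRamified.exists_common ha hb
    exact ⟨N, hN, add_mem h h'⟩
  algebraMap_mem' c := by
    rw [algebraMap_hahnSeries_eq]
    exact isRamified_single le_rfl _

theorem mem_puiseuxRing_iff {φ : HahnSeries ℚ ℂ} :
    φ ∈ puiseuxRing ↔ ∃ N : ℕ, 0 < N ∧ ∀ α, φ.coeff α ≠ 0 → ∃ n : ℕ, α = n / N := by
  constructor
  · rintro ⟨N, hN, h⟩
    exact ⟨N, hN, (mem_range_ramify_iff hN).1 h⟩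
  · rintro ⟨N, hN, h⟩
    exact ⟨N, hN, (mem_range_ramify_iff hN).2 h⟩

theorem coeff_eq_zero_of_neg (φ : puiseuxRing) {α : ℚ} (hα : α < 0) :
    (φ : HahnSeries ℚ ℂ).coeff α = 0 := by
  obtain ⟨N, hN, h⟩ := mem_puiseuxRing_iff.1 φ.2
  by_contra h0
  obtain ⟨n, rfl⟩ := h α h0
  exact absurd hα (not_lt.2 (by positivity))

/-- The residue map, sending a Puiseux series to its constant term. -/
noncomputable def residue : puiseuxRing →+* ℂ where
  toFun φ := (φ : HahnSeries ℚ ℂ).coeff 0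
  map_one' := by simp
  map_zero' := by simp
  map_add' a b := by simp
  map_mul' a b := by
    obtain ⟨N, hN, ⟨p, hp⟩, ⟨q, hq⟩⟩ := IsRamified.exists_common a.2 b.2
    have : ((a * b : puiseuxRing) : HahnSeries ℚ ℂ) = ramify N hN (p * q) := by
      rw [map_mul, hp, hq]; rfl
    rw [this, ← hp, ← hq, ramify_coeff_zero, ramify_coeff_zero, ramify_coeff_zero, map_mul]

theorem residue_apply (φ : puiseuxRing) : residue φ = (φ : HahnSeries ℚ ℂ).coeff 0 := rfl

/-- The monomial `c y^r`, for `r ≥ 0`. -/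
noncomputable def monom (r : ℚ) (hr : 0 ≤ r) (c : ℂ) : puiseuxRing :=
  ⟨HahnSeries.single r c, isRamified_single hr c⟩

@[simp] theorem coe_monom (r : ℚ) (hr : 0 ≤ r) (c : ℂ) :
    (monom r hr c : HahnSeries ℚ ℂ) = HahnSeries.single r c := rfl

theorem residue_monom_zero (c : ℂ) : residue (monom 0 le_rfl c) = c := by
  simp [residue_apply]

theorem residue_monom_pos {r : ℚ} (hr : 0 < r) (c : ℂ) : residue (monom r hr.le c) = 0 := by
  rw [residue_apply, coe_monom, HahnSeries.coeff_single_of_ne hr.ne]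

theorem monom_mul_monom {r s : ℚ} (hr : 0 ≤ r) (hs : 0 ≤ s) (a b : ℂ) :
    monom r hr a * monom s hs b = monom (r + s) (add_nonneg hr hs) (a * b) :=
  Subtype.ext (by simp [HahnSeries.single_mul_single])

theorem monom_pow {r : ℚ} (hr : 0 ≤ r) (n : ℕ) :
    monom r hr 1 ^ n = monom (n * r) (by positivity) 1 :=
  Subtype.ext (by simp [HahnSeries.single_pow])

theorem monom_ne_zero {r : ℚ} (hr : 0 ≤ r) : monom r hr 1 ≠ 0 := fun h => by
  have := congrArg (fun φ : puiseuxRing => (φ : HahnSeries ℚ ℂ).coeff r) h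
  simp at this

theorem coeff_monom_mul {r : ℚ} (hr : 0 ≤ r) (φ : puiseuxRing) (q : ℚ) :
    ((monom r hr 1 * φ : puiseuxRing) : HahnSeries ℚ ℂ).coeff q =
      (φ : HahnSeries ℚ ℂ).coeff (q - r) := by
  simp [HahnSeries.coeff_single_mul]

theorem exists_eq_monom_mul {r : ℚ} (hr : 0 ≤ r) (φ : puiseuxRing)
    (h : ∀ q < r, (φ : HahnSeries ℚ ℂ).coeff q = 0) :
    ∃ ψ : puiseuxRing, φ = monom r hr 1 * ψ := by
  obtain ⟨N, hN, hφ⟩ := mem_puiseuxRing_iff.1 φ.2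
  refine ⟨⟨HahnSeries.single (-r) 1 * (φ : HahnSeries ℚ ℂ), mem_puiseuxRing_iff.2
    ⟨N * r.den, Nat.mul_pos hN r.den_pos, fun α hα => ?_⟩⟩, Subtype.ext ?_⟩
  · rw [HahnSeries.coeff_single_mul, one_mul, sub_neg_eq_add] at hα
    obtain ⟨n, hn⟩ := hφ _ hα
    have hα0 : 0 ≤ α := by
      by_contra! h0
      exact hα (h _ (by linarith))
    have hN0 : (N : ℚ) ≠ 0 := by positivity
    have hd0 : (r.den : ℚ) ≠ 0 := by have := r.den_pos; positivity
    have hz : α = ((n * r.den - r.num * N : ℤ) : ℚ) / (N * r.den : ℕ) := by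
      have hr' : r * r.den = r.num := Rat.mul_den_eq_num r
      rw [eq_div_iff (by push_cast; positivity)]
      rw [eq_div_iff hN0] at hn
      push_cast
      linear_combination r.den * hn - N * hr'
    have hnn : (0 : ℤ) ≤ n * r.den - r.num * N := by
      by_contra! hneg
      have : α < 0 := by
        rw [hz]
        exact div_neg_of_neg_of_pos (by exact_mod_cast hneg)
          (by have := r.den_pos; positivity)
      linarith
    refine ⟨(n * r.den - r.num * N : ℤ).toNat, ?_⟩
    rw [hz]
    congr 1
    conv_lhs => rw [← Int.toNat_of_nonneg hnn]
    rw [Int.cast_natCast]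
  · change (φ : HahnSeries ℚ ℂ) =
      HahnSeries.single r 1 * (HahnSeries.single (-r) 1 * (φ : HahnSeries ℚ ℂ))
    rw [← mul_assoc, HahnSeries.single_mul_single, add_neg_cancel, mul_one,
      HahnSeries.single_zero_one, one_mul]

/-- Every nonzero Puiseux series is a monomial times a series with nonzero constant term. -/
theorem exists_eq_monom_mul_residue_ne_zero (φ : puiseuxRing) (hφ : φ ≠ 0) :
    ∃ (d : ℚ) (hd : 0 ≤ d) (u : puiseuxRing), φ = monom d hd 1 * u ∧ residue u ≠ 0 := by
  have hφ' : (φ : HahnSeries ℚ ℂ) ≠ 0 := fun h => hφ (Subtype.ext h)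
  have hc : (φ : HahnSeries ℚ ℂ).coeff (φ : HahnSeries ℚ ℂ).order ≠ 0 := by
    simpa using hφ'
  have hd : 0 ≤ (φ : HahnSeries ℚ ℂ).order := by
    by_contra! h
    exact hc (coeff_eq_zero_of_neg φ h)
  obtain ⟨u, hu⟩ := exists_eq_monom_mul hd φ fun q hq => HahnSeries.coeff_eq_zero_of_lt_order hq
  refine ⟨_, hd, u, hu, fun h => hc ?_⟩
  nth_rw 1 [hu]
  rw [coeff_monom_mul, sub_self]
  exact h

theorem exists_eq_monom_mul_of_residue_eq_zero (φ : puiseuxRing) (hφ : φ ≠ 0)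
    (h0 : residue φ = 0) :
    ∃ (d : ℚ) (hd : 0 < d) (u : puiseuxRing), φ = monom d hd.le 1 * u ∧ residue u ≠ 0 := by
  obtain ⟨d, hd, u, hu, hr⟩ := exists_eq_monom_mul_residue_ne_zero φ hφ
  refine ⟨d, lt_of_le_of_ne hd ?_, u, hu, hr⟩
  rintro rfl
  rw [hu, map_mul, residue_monom_zero, one_mul] at h0
  exact hr h0

/-! ### Hensel's lemma for Puiseux series -/

open Polynomial in
/-- Hensel's lemma at `0` for polynomials that need not be monic. Writing
`f = a₀ + a₁ X + X² E`, one has `v ^ (n + 2) f(a₀ / v) = a₀ M(v)` with `M` monic and congruent to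
`X ^ (n + 1) (X + a₁)`, so that the monic case gives a root `v` of `M` near `-a₁`. -/
theorem HenselianRing.exists_root_of_coeff_zero_mem {R : Type*} [CommRing R] (I : Ideal R)
    [HenselianRing R I] (f : R[X]) (h0 : f.coeff 0 ∈ I) (h1 : IsUnit (f.coeff 1)) :
    ∃ a ∈ I, f.eval a = 0 := by
  nontriviality R
  set a₀ := f.coeff 0
  set a₁ := f.coeff 1
  set Q : R[X] := f.divX.divX.comp (C a₀ * X) with hQ
  set n := Q.natDegree
  set M : R[X] := X ^ (n + 2) + (C a₁ * X ^ (n + 1) + C a₀ * reflect n Q) with hM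
  have hmonic : M.Monic := by
    refine monic_X_pow_add ?_
    refine lt_of_le_of_lt (degree_add_le _ _) (max_lt ?_ ?_)
    · refine lt_of_le_of_lt (degree_C_mul_X_pow_le _ _) ?_
      exact_mod_cast Nat.lt_succ_self _
    · rw [← smul_eq_C_mul]
      refine lt_of_le_of_lt (degree_smul_le _ _) ?_
      refine lt_of_le_of_lt degree_le_natDegree ?_
      have : (reflect n Q).natDegree ≤ n := (natDegree_reflect_le).trans (by simp [n])
      exact_mod_cast (by omega : (reflect n Q).natDegree < n + 2)
  have hI : Ideal.Quotient.mk I a₀ = 0 := Ideal.Quotient.eq_zero_iff_mem.2 h0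
  obtain ⟨v, hv, hvI⟩ := HenselianRing.is_henselian (I := I) M hmonic (-a₁)
    (by
      rw [← Ideal.Quotient.eq_zero_iff_mem]
      simp only [hM, eval_add, eval_pow, eval_X, eval_mul, eval_C, map_add, map_mul, hI, map_pow,
        map_neg]
      ring)
    (by
      have : Ideal.Quotient.mk I (M.derivative.eval (-a₁)) =
          Ideal.Quotient.mk I ((-a₁) ^ (n + 1)) := by
        simp only [hM, derivative_X_pow, derivative_mul, derivative_C, eval_add,
          eval_mul, eval_pow, eval_X, eval_C, map_add, map_mul, hI, map_pow, map_neg, zero_mul,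
          zero_add, add_zero, Nat.add_sub_cancel, map_natCast,
          eval_natCast]
        push_cast
        ring
      rw [this]
      exact (h1.neg.pow _).map _)
  have hvu : IsUnit v := by
    have hj := (HenselianRing.jac (R := R) (I := I)) hvI
    rw [Ideal.mem_jacobson_bot] at hj
    obtain ⟨w, hw⟩ := h1.neg
    have h2 := hj (↑w⁻¹)
    have h3 : v = -a₁ * ((v - -a₁) * ↑w⁻¹ + 1) := by
      rw [← hw]
      linear_combination (-(v - (w : R))) * w.mul_inv
    rw [h3]
    exact h1.neg.mul h2
  obtain ⟨u, rfl⟩ := hvu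
  have hrefl : (reflect n Q).eval (u : R) = (u : R) ^ n * Q.eval (↑u⁻¹ : R) := by
    let _ : Invertible (↑u⁻¹ : R) := ⟨↑u, by simp, by simp⟩
    have h := eval₂_reflect_mul_pow (RingHom.id R) (↑u⁻¹ : R) n Q le_rfl
    have hinv : (⅟(↑u⁻¹ : R)) = (u : R) := rfl
    rw [hinv] at h
    rw [eval, eval, ← h, mul_comm, mul_assoc, ← mul_pow]
    simp
  refine ⟨a₀ * ↑u⁻¹, I.mul_mem_right _ h0, ?_⟩
  have hf : f = f.divX.divX * X ^ 2 + C a₁ * X + C a₀ := by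
    have e1 := divX_mul_X_add f
    have e2 := divX_mul_X_add f.divX
    rw [coeff_divX] at e2
    rw [zero_add] at e2
    linear_combination -e1 - X * e2
  have hQe : Q.eval (↑u⁻¹ : R) = f.divX.divX.eval (a₀ * ↑u⁻¹) := by
    simp [hQ]
  have hroot : (u : R) ^ (n + 2) + (a₁ * (u : R) ^ (n + 1) + a₀ * ((u : R) ^ n * Q.eval (↑u⁻¹ : R)))
      = 0 := by
    have := hv.eq_zero
    simpa only [hM, eval_add, eval_pow, eval_X, eval_mul, eval_C, hrefl] using this
  rw [hf]
  simp only [eval_add, eval_mul, eval_pow, eval_X, eval_C]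
  rw [← hQe]
  have hu : (u : R) * ↑u⁻¹ = 1 := u.mul_inv
  have : (u : R) ^ (n + 2) * (Q.eval (↑u⁻¹ : R) * (a₀ * ↑u⁻¹) ^ 2 + a₁ * (a₀ * ↑u⁻¹) + a₀) = 0 := by
    calc _ = a₀ * ((u : R) ^ (n + 2) + (a₁ * (u : R) ^ (n + 1) * ((u : R) * ↑u⁻¹)
        + a₀ * ((u : R) ^ n * Q.eval (↑u⁻¹ : R)) * ((u : R) * ↑u⁻¹) ^ 2)) := by ring
      _ = 0 := by rw [hu, one_pow, mul_one, mul_one, hroot, mul_zero]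
  exact (u.isUnit.pow (n + 2)).mul_right_eq_zero.1 this

/-- Finitely many Puiseux series have a common denominator of exponents. -/
theorem exists_common_ramify (f : Polynomial puiseuxRing) :
    ∃ (N : ℕ) (hN : 0 < N), ∀ i, (f.coeff i : HahnSeries ℚ ℂ) ∈ (ramify N hN).range := by
  suffices h : ∀ n, ∃ (N : ℕ) (hN : 0 < N), ∀ i < n,
      (f.coeff i : HahnSeries ℚ ℂ) ∈ (ramify N hN).range by
    obtain ⟨N, hN, h⟩ := h (f.natDegree + 1)
    refine ⟨N, hN, fun i => ?_⟩
    by_cases hi : i < f.natDegree + 1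
    · exact h i hi
    · rw [Polynomial.coeff_eq_zero_of_natDegree_lt (by omega)]
      exact zero_mem _
  intro n
  induction n with
  | zero => exact ⟨1, one_pos, by simp⟩
  | succ n ih =>
    obtain ⟨N, hN, h⟩ := ih
    obtain ⟨M, hM, h'⟩ := (f.coeff n).2
    refine ⟨N * M, Nat.mul_pos hN hM, fun i hi => ?_⟩
    rcases Nat.lt_succ_iff_lt_or_eq.1 hi with hi | rfl
    · exact range_ramify_le_mul hN hM (h i hi)
    · have := range_ramify_le_mul hM hN h'
      simpa only [mul_comm M N] using this

/-- Hensel's lemma for a simple residual root at `0`, deduced from power series in `y^(1/N)`. -/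
theorem exists_root_of_simple (f : Polynomial puiseuxRing) (h0 : residue (f.coeff 0) = 0)
    (h1 : residue (f.coeff 1) ≠ 0) : ∃ z, residue z = 0 ∧ f.eval z = 0 := by
  obtain ⟨N, hN, hf⟩ := exists_common_ramify f
  let e : PowerSeries ℂ →+* puiseuxRing :=
    (ramify N hN).codRestrict puiseuxRing (fun p => ⟨N, hN, p, rfl⟩)
  have he : ∀ p, residue (e p) = PowerSeries.constantCoeff p := ramify_coeff_zero N hN
  have hl : f ∈ Polynomial.lifts e := by
    rw [Polynomial.lifts_iff_coeff_lifts]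
    intro i
    obtain ⟨p, hp⟩ := hf i
    exact ⟨p, Subtype.ext hp⟩
  obtain ⟨g, rfl⟩ := (Polynomial.mem_lifts _).1 hl
  rw [Polynomial.coeff_map, he] at h0 h1
  obtain ⟨a, ha, hga⟩ := HenselianRing.exists_root_of_coeff_zero_mem
    (Ideal.span {(PowerSeries.X : PowerSeries ℂ)}) g
    (Ideal.mem_span_singleton.2 (PowerSeries.X_dvd_iff.2 h0))
    (PowerSeries.isUnit_iff_constantCoeff.2 (isUnit_iff_ne_zero.2 h1))
  refine ⟨e a, ?_, ?_⟩
  · rw [he]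
    exact PowerSeries.X_dvd_iff.1 (Ideal.mem_span_singleton.1 ha)
  · rw [Polynomial.eval_map_apply, hga, map_zero]

/-! ### The Newton–Puiseux theorem -/

open Polynomial in
/-- A polynomial of degree `n` without term of degree `n - 1` that is not a monomial has a root of
multiplicity less than `n`, because `c (X - α) ^ n` has no term of degree `n - 1` only if
`α = 0`. -/
theorem exists_taylor_trailing_lt (p : ℂ[X]) (n : ℕ) (hn : p.natDegree = n)
    (hn1 : p.coeff (n - 1) = 0) (i₀ : ℕ) (hi₀ : i₀ < n) (hpi : p.coeff i₀ ≠ 0) :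
    ∃ (α : ℂ) (m : ℕ), 0 < m ∧ m < n ∧ (∀ i < m, (taylor α p).coeff i = 0) ∧
      (taylor α p).coeff m ≠ 0 := by
  have hp : p ≠ 0 := by rintro rfl; simp at hpi
  obtain ⟨α, hα⟩ := IsAlgClosed.exists_root p
    (by rw [degree_eq_natDegree hp, hn]; exact_mod_cast (by omega : n ≠ 0))
  set q := taylor α p with hq
  have hq0 : q ≠ 0 := by simpa [hq, taylor_eq_zero] using hp
  have hlow : ∀ i < q.natTrailingDegree, q.coeff i = 0 :=
    fun i hi => coeff_eq_zero_of_lt_natTrailingDegree hi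
  have htr : q.coeff q.natTrailingDegree ≠ 0 := by
    simpa [trailingCoeff] using (trailingCoeff_nonzero_iff_nonzero.2 hq0)
  have hqn : q.natDegree = n := by rw [hq, natDegree_taylor, hn]
  have hle : q.natTrailingDegree ≤ n := hqn ▸ natTrailingDegree_le_natDegree q
  refine ⟨α, q.natTrailingDegree, ?_, lt_of_le_of_ne hle ?_, hlow, htr⟩
  · refine Nat.pos_of_ne_zero fun h => htr ?_
    rw [h, hq, taylor_coeff_zero]
    exact hα
  · intro heq
    have hmon : q = C (q.coeff n) * X ^ n := by
      ext i
      rw [coeff_C_mul_X_pow]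
      rcases lt_trichotomy i n with h | h | h
      · rw [if_neg h.ne, hlow i (heq ▸ h)]
      · rw [if_pos h, h]
      · rw [if_neg h.ne', coeff_eq_zero_of_natDegree_lt (hqn ▸ h)]
    have hpq : p = C (q.coeff n) * (X + C (-α)) ^ n := by
      have h1 : taylor (-α) q = p := by rw [hq, taylor_taylor]; simp
      rw [← h1]
      conv_lhs => rw [hmon]
      simp [taylor_mul]
    have hcn : q.coeff n ≠ 0 := heq ▸ htr
    have h0 : α = 0 := by
      rw [hpq, coeff_C_mul, coeff_X_add_C_pow, show n - (n - 1) = 1 by omega] at hn1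
      have : ((n.choose (n - 1) : ℕ) : ℂ) ≠ 0 :=
        Nat.cast_ne_zero.2 (Nat.choose_pos (Nat.sub_le _ _)).ne'
      simpa [hcn, this] using hn1
    apply hpi
    have : p = q := by rw [hq, h0, taylor_zero]
    rw [this]
    exact hlow i₀ (heq ▸ hi₀)

open Polynomial in
theorem map_taylor_residue (z : puiseuxRing) (H : puiseuxRing[X]) :
    (taylor z H).map residue = taylor (residue z) (H.map residue) := by
  simp [taylor_apply, Polynomial.map_comp]

open Polynomial in
/-- One step of the Newton–Puiseux algorithm: rescaling `X` by the power of `y` given by the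
steepest edge of the Newton polygon. Here the Newton polygon of `H` ends at the vertex `(n, 0)`. -/
theorem exists_newton_rescaling (H : puiseuxRing[X]) (n : ℕ) (hlow : ∀ i < n,
    residue (H.coeff i) = 0) (hH0 : H.coeff 0 ≠ 0) (hn : 0 < n) :
    ∃ (r : ℚ) (hr : 0 < r) (H' : puiseuxRing[X]),
      H.comp (C (monom r hr.le 1) * X) = C (monom (n * r) (by positivity) 1) * H' ∧
      (∀ i, n < i → residue (H'.coeff i) = 0) ∧ H'.coeff n = H.coeff n ∧
      (H.coeff (n - 1) = 0 → H'.coeff (n - 1) = 0) ∧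
      ∃ i₀ < n, residue (H'.coeff i₀) ≠ 0 := by
  classical
  have key : ∀ i, ∃ (d : ℚ) (hd : 0 ≤ d) (u : puiseuxRing), (i < n → 0 < d) ∧
      H.coeff i = monom d hd 1 * u ∧ (H.coeff i ≠ 0 → residue u ≠ 0) := by
    intro i
    by_cases h0 : H.coeff i = 0
    · exact ⟨1, zero_le_one, 0, fun _ => one_pos, by simp [h0], fun h => (h h0).elim⟩
    by_cases hi : i < n
    · obtain ⟨d, hd, u, h, hu⟩ := exists_eq_monom_mul_of_residue_eq_zero _ h0 (hlow i hi)
      exact ⟨d, hd.le, u, fun _ => hd, h, fun _ => hu⟩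
    · obtain ⟨d, hd, u, h, hu⟩ := exists_eq_monom_mul_residue_ne_zero _ h0
      exact ⟨d, hd, u, fun h => (hi h).elim, h, fun _ => hu⟩
  choose d hd u hdpos hdu hu using key
  obtain ⟨i₀, hi₀, hmin⟩ := ((Finset.range n).filter fun i => H.coeff i ≠ 0).exists_min_image
    (fun i => d i / ((n : ℚ) - i)) ⟨0, by simp [hn, hH0]⟩
  simp only [Finset.mem_filter, Finset.mem_range] at hi₀ hmin
  have hpos : ∀ {i : ℕ}, i < n → (0 : ℚ) < (n : ℚ) - i := fun h => by
    have : (_ : ℚ) < n := Nat.cast_lt.2 h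
    linarith
  set r := d i₀ / ((n : ℚ) - i₀) with hr_def
  have hr : 0 < r := div_pos (hdpos _ hi₀.1) (hpos hi₀.1)
  have hle : ∀ i < n, H.coeff i ≠ 0 → n * r ≤ d i + i * r := by
    intro i hi h0
    have := hmin i ⟨hi, h0⟩
    rw [le_div_iff₀ (hpos hi)] at this
    linarith
  have heq : (n : ℚ) * r = d i₀ + i₀ * r := by
    have := (hpos hi₀.1).ne'
    have h2 : r * ((n : ℚ) - i₀) = d i₀ := by rw [hr_def]; field_simp
    linarith
  have hnr : (0 : ℚ) ≤ n * r := by positivity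
  -- the coefficients of the rescaled polynomial, divided by `y ^ (n r)`
  have hcoef : ∀ i, ∃ (e : ℚ) (he : 0 ≤ e), (H.coeff i ≠ 0 → i ≤ n → n * r + e = d i + i * r) ∧
      (n < i → 0 < e) ∧
      H.coeff i * monom r hr.le 1 ^ i = monom (n * r) hnr 1 * (monom e he 1 * u i) := by
    intro i
    have hexp : ∀ e (he : 0 ≤ e), n * r + e = d i + i * r →
        H.coeff i * monom r hr.le 1 ^ i = monom (n * r) hnr 1 * (monom e he 1 * u i) := by
      intro e he h
      have h1 : monom (n * r) hnr 1 * monom e he 1 = monom (d i) (hd i) 1 * monom r hr.le 1 ^ i := by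
        rw [monom_pow, monom_mul_monom, monom_mul_monom]
        simp only [h]
      rw [← mul_assoc, h1]
      conv_lhs => rw [hdu i]
      ring
    rcases lt_or_ge n i with hi | hi
    · have h1 : (n : ℚ) * r < i * r := by
        have : (n : ℚ) < i := Nat.cast_lt.2 hi
        exact mul_lt_mul_of_pos_right this hr
      have h2 := hd i
      exact ⟨d i + i * r - n * r, by linarith, fun _ h => absurd hi (by omega),
        fun _ => by linarith, hexp _ _ (by ring)⟩
    · by_cases h0 : H.coeff i = 0
      · refine ⟨0, le_rfl, fun h => (h h0).elim, fun h => absurd h (by omega), ?_⟩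
        have hu0 : u i = 0 := by
          have := hdu i
          rw [h0] at this
          exact (mul_eq_zero.1 this.symm).resolve_left (monom_ne_zero _)
        rw [h0, hu0]
        simp
      · have h1 : n * r ≤ d i + i * r := by
          rcases hi.lt_or_eq with h | h
          · exact hle i h h0
          · have := hd i
            rw [← h]
            linarith
        exact ⟨d i + i * r - n * r, by linarith, fun _ _ => by ring,
          fun h => absurd h (by omega), hexp _ _ (by ring)⟩
  choose e he hed hepos hmul using hcoef
  set H' : puiseuxRing[X] := ∑ i ∈ H.support, monomial i (monom (e i) (he i) 1 * u i) with hH'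
  have hzero : ∀ i, H.coeff i = 0 → u i = 0 := by
    intro i h0
    have := hdu i
    rw [h0] at this
    exact (mul_eq_zero.1 this.symm).resolve_left (monom_ne_zero _)
  have hc : ∀ i, H'.coeff i = monom (e i) (he i) 1 * u i := by
    intro i
    simp only [hH', finsetSum_coeff, coeff_monomial, Finset.sum_ite_eq', mem_support_iff]
    split_ifs with h
    · rfl
    · rw [hzero i (not_not.1 h), mul_zero]
  refine ⟨r, hr, H', ?_, ?_, ?_, ?_, i₀, hi₀.1, ?_⟩
  · ext1 i
    rw [comp_C_mul_X_coeff, coeff_C_mul, hc, hmul]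
  · intro i hi
    rw [hc, map_mul, residue_monom_pos (hepos i hi), zero_mul]
  · have h := hmul n
    rw [monom_pow, mul_comm] at h
    rw [hc]
    exact (mul_left_cancel₀ (monom_ne_zero _) h).symm
  · intro h
    rw [hc, hzero _ h, mul_zero]
  · have h1 : e i₀ = 0 := by
      have := hed i₀ hi₀.2 hi₀.1.le
      linarith
    rw [hc, map_mul]
    simp only [h1, residue_monom_zero, one_mul]
    exact hu i₀ hi₀.2

open Polynomial in
/-- The Newton–Puiseux theorem, in local form: a polynomial over the Puiseux series whose residue
polynomial vanishes at `0` to the finite order `n ≥ 1` has a root without constant term. -/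
theorem exists_root_residue_eq_zero (n : ℕ) (hn : 0 < n) (H : puiseuxRing[X])
    (hlow : ∀ i < n, residue (H.coeff i) = 0) (hHn : residue (H.coeff n) ≠ 0) :
    ∃ z, residue z = 0 ∧ H.eval z = 0 := by
  induction n using Nat.strong_induction_on generalizing H with
  | _ n ih =>
  -- translating by a root of the Hasse derivative of order `n - 1` kills the term of degree `n - 1`
  obtain ⟨z₀, hz₀, hroot⟩ := exists_root_of_simple (hasseDeriv (n - 1) H)
    (by
      rw [hasseDeriv_coeff]
      simp [hlow (n - 1) (by omega)])
    (by
      rw [hasseDeriv_coeff, show 1 + (n - 1) = n by omega, map_mul, map_natCast]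
      exact mul_ne_zero (Nat.cast_ne_zero.2 (Nat.choose_pos (Nat.sub_le _ _)).ne') hHn)
  set H₁ := taylor z₀ H with hH₁
  have hres : ∀ i, residue (H₁.coeff i) = residue (H.coeff i) := by
    intro i
    rw [← coeff_map, hH₁, map_taylor_residue, hz₀, taylor_zero, coeff_map]
  have hn1 : H₁.coeff (n - 1) = 0 := by rw [hH₁, taylor_coeff, hroot]
  by_cases h0 : H₁.coeff 0 = 0
  · exact ⟨z₀, hz₀, by rwa [hH₁, taylor_coeff_zero] at h0⟩
  obtain ⟨r, hr, H₂, hcomp, hhigh, hlead, hsub, i₀, hi₀, hH₂⟩ :=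
    exists_newton_rescaling H₁ n (fun i hi => by rw [hres, hlow i hi]) h0 hn
  have hdeg : (H₂.map residue).natDegree = n := by
    refine natDegree_eq_of_le_of_coeff_ne_zero ?_ ?_
    · rw [natDegree_le_iff_coeff_eq_zero]
      intro i hi
      rw [coeff_map, hhigh i hi]
    · rw [coeff_map, hlead, hres]
      exact hHn
  obtain ⟨α, m, hm, hmn, hml, hmc⟩ := exists_taylor_trailing_lt (H₂.map residue) n hdeg
    (by rw [coeff_map, hsub hn1, map_zero]) i₀ hi₀ (by rwa [coeff_map])
  have hα : taylor α (H₂.map residue) = (taylor (monom 0 le_rfl α) H₂).map residue := by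
    rw [map_taylor_residue, residue_monom_zero]
  obtain ⟨w, hw, hwroot⟩ := ih m hmn hm (taylor (monom 0 le_rfl α) H₂)
    (fun i hi => by rw [← coeff_map, ← hα, hml i hi]) (by rwa [← coeff_map, ← hα])
  refine ⟨monom r hr.le 1 * (w + monom 0 le_rfl α) + z₀, ?_, ?_⟩
  · rw [map_add, map_mul, residue_monom_pos hr, zero_mul, hz₀, add_zero]
  · rw [taylor_eval] at hwroot
    have h := congrArg (eval (w + monom 0 le_rfl α)) hcomp
    rw [eval_comp, eval_mul (p := C (monom (n * r) _ 1)), hwroot, mul_zero] at h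
    rw [← taylor_eval, ← hH₁]
    simpa using h

/-! ### Expansions of `f` along a series -/

open Polynomial in
theorem taylor_aeval_X_add_C {A : Type*} [CommRing A] [Algebra ℝ A] (f : MvPolynomial (Fin 2) ℝ)
    (φ ψ a : A) : taylor ψ (MvPolynomial.aeval ![X + C φ, C a] f) =
      MvPolynomial.aeval ![X + C (φ + ψ), C a] f := by
  refine (MvPolynomial.comp_aeval_apply _ ((taylorAlgHom ψ).restrictScalars ℝ) f).trans ?_
  congr 2
  funext i
  fin_cases i
  · simp [add_assoc, add_comm (C ψ)]
  · simp

open Polynomial in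
theorem eval_aeval_X_add_C {A : Type*} [CommRing A] [Algebra ℝ A] (f : MvPolynomial (Fin 2) ℝ)
    (φ ψ a : A) : (MvPolynomial.aeval ![X + C φ, C a] f).eval ψ =
      MvPolynomial.aeval ![φ + ψ, a] f := by
  refine (MvPolynomial.comp_aeval_apply _ ((aeval (R := A) ψ).restrictScalars ℝ) f).trans ?_
  congr 2
  funext i
  fin_cases i
  · simp [add_comm ψ]
  · simp

theorem eval_expandAlong (f : MvPolynomial (Fin 2) ℝ) (φ ψ : HahnSeries ℚ ℂ) :
    (expandAlong f φ).eval ψ = evalAlong f (φ + ψ) :=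
  eval_aeval_X_add_C f φ ψ _

/-- `f(X + φ(Y), Y)` for a Puiseux series `φ`, as a polynomial over the ring of Puiseux series. -/
noncomputable def puiseuxExpand (f : MvPolynomial (Fin 2) ℝ) (φ : puiseuxRing) :
    Polynomial puiseuxRing :=
  MvPolynomial.aeval ![Polynomial.X + Polynomial.C φ, Polynomial.C (monom 1 zero_le_one 1)] f

theorem map_puiseuxExpand (f : MvPolynomial (Fin 2) ℝ) (φ : puiseuxRing) :
    (puiseuxExpand f φ).map (puiseuxRing.val : puiseuxRing →+* HahnSeries ℚ ℂ) =
      expandAlong f φ := by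
  refine (MvPolynomial.comp_aeval_apply (S₁ := Polynomial puiseuxRing)
    (B := Polynomial (HahnSeries ℚ ℂ)) _ (Polynomial.mapAlgHom puiseuxRing.val) f).trans ?_
  unfold expandAlong
  congr 2
  funext i
  fin_cases i
  · simp
  · simp [yMonomial]

theorem coeff_expandAlong (f : MvPolynomial (Fin 2) ℝ) (φ : puiseuxRing) (i : ℕ) :
    (expandAlong f φ).coeff i = ((puiseuxExpand f φ).coeff i : HahnSeries ℚ ℂ) := by
  rw [← map_puiseuxExpand, Polynomial.coeff_map]
  rfl

theorem taylor_puiseuxExpand (f : MvPolynomial (Fin 2) ℝ) (φ ψ : puiseuxRing) :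
    Polynomial.taylor ψ (puiseuxExpand f φ) = puiseuxExpand f (φ + ψ) :=
  taylor_aeval_X_add_C f φ ψ _

theorem coe_eval_puiseuxExpand (f : MvPolynomial (Fin 2) ℝ) (φ ψ : puiseuxRing) :
    (((puiseuxExpand f φ).eval ψ : puiseuxRing) : HahnSeries ℚ ℂ) = evalAlong f (φ + ψ) := by
  rw [← eval_expandAlong, ← map_puiseuxExpand]
  exact (Polynomial.eval_map_apply (f := (puiseuxRing.val : puiseuxRing →+* HahnSeries ℚ ℂ))
    ψ).symm

theorem rootMult_eq_rootMultiplicity_zero (f : MvPolynomial (Fin 2) ℝ) (γ : puiseuxRing) :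
    rootMult f γ = (puiseuxExpand f γ).rootMultiplicity (0 : puiseuxRing) := by
  have h := taylor_aeval_X_add_C f 0 (γ : HahnSeries ℚ ℂ) (yMonomial 1 1)
  rw [zero_add] at h
  rw [rootMult, Polynomial.rootMultiplicity_eq_rootMultiplicity, ← Polynomial.taylor_apply]
  unfold expandAlong
  rw [h]
  change Polynomial.rootMultiplicity 0 (expandAlong f γ) = _
  have hinj : Function.Injective (puiseuxRing.val : puiseuxRing →+* HahnSeries ℚ ℂ) :=
    Subtype.val_injective
  rw [← map_puiseuxExpand, Polynomial.eq_rootMultiplicity_map (A := puiseuxRing)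
    (B := HahnSeries ℚ ℂ) hinj, map_zero]

/-- Along the zero series the Newton coefficients are the coefficients of `f`. In particular the
expansion does not vanish unless `f` does. -/
theorem newtonCoeff_zero (f : MvPolynomial (Fin 2) ℝ) (s : Fin 2 →₀ ℕ) :
    newtonCoeff f 0 (s 0) (s 1) = ((f.coeff s : ℝ) : ℂ) := by
  unfold newtonCoeff expandAlong
  induction f using MvPolynomial.induction_on' with
  | add p q hp hq =>
    rw [map_add, Polynomial.coeff_add, HahnSeries.coeff_add, hp, hq, MvPolynomial.coeff_add,
      Complex.ofReal_add]
  | monomial u a =>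
    rw [MvPolynomial.aeval_monomial, Finsupp.prod_fintype _ _ (fun _ => pow_zero _)]
    have : algebraMap ℝ (Polynomial (HahnSeries ℚ ℂ)) a =
        Polynomial.C (HahnSeries.single 0 (a : ℂ)) := by
      rw [← algebraMap_hahnSeries_eq]; rfl
    rw [this]
    simp only [Fin.prod_univ_two, Matrix.cons_val_zero, Matrix.cons_val_one, map_zero, add_zero,
      yMonomial, ← map_pow, HahnSeries.single_pow, one_pow, nsmul_eq_mul, mul_one,
      Polynomial.coeff_C_mul, Polynomial.coeff_mul_C, Polynomial.coeff_X_pow]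
    rw [MvPolynomial.coeff_monomial]
    by_cases h0 : s 0 = u 0
    · rw [if_pos h0, one_mul, HahnSeries.single_mul_single, zero_add, mul_one]
      by_cases h1 : s 1 = u 1
      · have : u = s := by
          ext i
          fin_cases i
          · exact h0.symm
          · exact h1.symm
        rw [if_pos this, h1, HahnSeries.coeff_single_same]
      · rw [if_neg (fun h => h1 (by rw [h])), HahnSeries.coeff_single_of_ne (by exact_mod_cast h1)]
        simp
    · rw [if_neg h0, if_neg (fun h => h0 (by rw [h]))]
      simp

theorem expandAlong_zero_ne_zero {f : MvPolynomial (Fin 2) ℝ} (hf : f ≠ 0) :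
    expandAlong f 0 ≠ 0 := by
  intro h
  apply hf
  ext s
  have := newtonCoeff_zero f s
  rw [newtonCoeff, h] at this
  simpa using this.symm

theorem puiseuxExpand_ne_zero {f : MvPolynomial (Fin 2) ℝ} (hf : f ≠ 0) (φ : puiseuxRing) :
    puiseuxExpand f φ ≠ 0 := by
  intro h
  apply expandAlong_zero_ne_zero hf
  have h' := taylor_puiseuxExpand f φ (-φ)
  rw [h, add_neg_cancel φ, map_zero] at h'
  have h2 := map_puiseuxExpand f 0
  rw [← h', Polynomial.map_zero] at h2
  exact h2.symm

theorem XRegular.ne_zero {f : MvPolynomial (Fin 2) ℝ} (hf : XRegular f) : f ≠ 0 := by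
  rintro rfl
  obtain ⟨m, -, hm⟩ := hf
  simp at hm

theorem finite_newtonPuiseuxRoots {f : MvPolynomial (Fin 2) ℝ} (hf : f ≠ 0) :
    (newtonPuiseuxRoots f).Finite := by
  classical
  refine (expandAlong f 0).roots.toFinset.finite_toSet.subset fun γ hγ => ?_
  simp only [Finset.mem_coe, Multiset.mem_toFinset, Polynomial.mem_roots',
    Polynomial.IsRoot.def]
  refine ⟨expandAlong_zero_ne_zero hf, ?_⟩
  rw [eval_expandAlong, zero_add]
  exact hγ.2

theorem newtonPuiseuxRoots_subset_of_dvd {f g : MvPolynomial (Fin 2) ℝ} (h : f ∣ g) :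
    newtonPuiseuxRoots f ⊆ newtonPuiseuxRoots g := by
  rintro ξ ⟨hξ, h0⟩
  obtain ⟨k, rfl⟩ := h
  refine ⟨hξ, ?_⟩
  unfold evalAlong at h0 ⊢
  rw [map_mul, h0, zero_mul]

/-! ### Orders and the contact order -/

theorem lt_orderTop_iff_forall_coeff (φ : HahnSeries ℚ ℂ) (ρ : ℚ) :
    (ρ : WithTop ℚ) < φ.orderTop ↔ ∀ q ≤ ρ, φ.coeff q = 0 := by
  constructor
  · intro h q hq
    exact HahnSeries.coeff_eq_zero_of_lt_orderTop (lt_of_le_of_lt (WithTop.coe_le_coe.2 hq) h)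
  · intro h
    refine lt_of_le_of_ne (HahnSeries.le_orderTop_iff_forall.2 fun j hj =>
      h j (WithTop.coe_lt_coe.1 hj).le) fun he => ?_
    exact HahnSeries.orderTop_ne_of_coeff_eq_zero (h ρ le_rfl) he.symm

theorem orderTop_monom_mul {e : ℚ} (he : 0 ≤ e) {u : puiseuxRing} (hu : residue u ≠ 0) :
    ((monom e he 1 * u : puiseuxRing) : HahnSeries ℚ ℂ).orderTop = (e : WithTop ℚ) := by
  refine le_antisymm (HahnSeries.orderTop_le_of_coeff_ne_zero ?_)
    (HahnSeries.le_orderTop_iff_forall.2 fun j hj => ?_)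
  · rw [coeff_monom_mul, sub_self]
    exact hu
  · rw [coeff_monom_mul]
    exact coeff_eq_zero_of_neg u (sub_neg.2 (WithTop.coe_lt_coe.1 hj))

theorem isPuiseux_iff (φ : HahnSeries ℚ ℂ) :
    IsPuiseux φ ↔ φ ∈ puiseuxRing ∧ ∀ q < 1, φ.coeff q = 0 := by
  rw [mem_puiseuxRing_iff]
  constructor
  · rintro ⟨N, hN, h⟩
    have hN' : (0 : ℚ) < N := Nat.cast_pos.2 hN
    refine ⟨⟨N, hN, fun α hα => ?_⟩, fun q hq => ?_⟩
    · obtain ⟨n, -, hn⟩ := h α hα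
      exact ⟨n, hn⟩
    · by_contra h0
      obtain ⟨n, hn, rfl⟩ := h q h0
      rw [div_lt_one hN'] at hq
      exact absurd (Nat.cast_lt.1 hq) (by omega)
  · rintro ⟨⟨N, hN, h⟩, h1⟩
    have hN' : (0 : ℚ) < N := Nat.cast_pos.2 hN
    refine ⟨N, hN, fun α hα => ?_⟩
    obtain ⟨n, rfl⟩ := h α hα
    refine ⟨n, ?_, rfl⟩
    by_contra! hlt
    exact hα (h1 _ ((div_lt_one hN').2 (Nat.cast_lt.2 hlt)))

theorem exists_isContactOrder {f : MvPolynomial (Fin 2) ℝ} (hf : f ≠ 0) {γ : HahnSeries ℚ ℂ}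
    (hother : ∃ γ' ∈ newtonPuiseuxRoots f, γ' ≠ γ) : ∃ ρ, IsContactOrder γ f ρ := by
  obtain ⟨γ₀, h₀, hmax⟩ := Set.exists_max_image {γ' | γ' ∈ newtonPuiseuxRoots f ∧ γ' ≠ γ}
    (fun γ' => (γ - γ').order) ((finite_newtonPuiseuxRoots hf).subset fun _ h => h.1)
    (by obtain ⟨γ', h⟩ := hother; exact ⟨γ', h⟩)
  have hord : ∀ γ', γ' ≠ γ → (γ - γ').orderTop = (((γ - γ').order : ℚ) : WithTop ℚ) :=
    fun γ' h => (HahnSeries.order_eq_orderTop_of_ne_zero (sub_ne_zero.2 h.symm)).symm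
  refine ⟨(γ - γ₀).order, ⟨γ₀, h₀.1, h₀.2, hord _ h₀.2⟩, ?_⟩
  rintro r ⟨γ', h, hne, hr⟩
  rw [hord _ hne] at hr
  rw [← WithTop.coe_inj.1 hr]
  exact hmax γ' ⟨h, hne⟩

/-- A Newton–Puiseux root that agrees with `γ` up to the contact order is `γ` itself. -/
theorem IsContactOrder.eq_of_coeff_eq {f : MvPolynomial (Fin 2) ℝ} {γ ξ : HahnSeries ℚ ℂ} {ρ : ℚ}
    (hρ : IsContactOrder γ f ρ) (hξ : ξ ∈ newtonPuiseuxRoots f)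
    (h : ∀ q ≤ ρ, ξ.coeff q = γ.coeff q) : ξ = γ := by
  by_contra hne
  have h1 : (ρ : WithTop ℚ) < (γ - ξ).orderTop := by
    rw [lt_orderTop_iff_forall_coeff]
    intro q hq
    simp [h q hq]
  have h2 := (HahnSeries.order_eq_orderTop_of_ne_zero (sub_ne_zero.2 (Ne.symm hne))).symm
  have h3 := hρ.2 ⟨ξ, hξ, hne, h2⟩
  rw [h2, WithTop.coe_lt_coe] at h1
  exact absurd h3 (not_le.2 h1)

theorem IsContactOrder.one_le {f : MvPolynomial (Fin 2) ℝ} {γ : HahnSeries ℚ ℂ} {ρ : ℚ}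
    (hρ : IsContactOrder γ f ρ) (hγ : γ ∈ newtonPuiseuxRoots f) : 1 ≤ ρ := by
  obtain ⟨γ', h, -, hord⟩ := hρ.1
  by_contra! hlt
  refine HahnSeries.orderTop_ne_of_coeff_eq_zero (x := γ - γ') (i := ρ) ?_ hord
  simp [((isPuiseux_iff γ).1 hγ.1).2 ρ hlt, ((isPuiseux_iff γ').1 h.1).2 ρ hlt]

theorem coeff_truncLE (ρ : ℚ) (φ : HahnSeries ℚ ℂ) (q : ℚ) :
    (truncLE ρ φ).coeff q = if q ≤ ρ then φ.coeff q else 0 := rfl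

theorem truncLE_mem_puiseuxRing (ρ : ℚ) {φ : HahnSeries ℚ ℂ} (h : φ ∈ puiseuxRing) :
    truncLE ρ φ ∈ puiseuxRing := by
  rw [mem_puiseuxRing_iff] at h ⊢
  obtain ⟨N, hN, h⟩ := h
  refine ⟨N, hN, fun α hα => h α fun h0 => hα ?_⟩
  rw [coeff_truncLE, h0, ite_self]

/-! ### Conjugation -/

/-- Conjugation of the coefficients of a series. It is an `ℝ`-algebra homomorphism. -/
noncomputable def conjSeries : HahnSeries ℚ ℂ →ₐ[ℝ] HahnSeries ℚ ℂ where
  toFun φ := φ.map (starRingEnd ℂ)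
  map_one' := by
    ext q
    by_cases h : q = 0 <;> simp [HahnSeries.coeff_one, h]
  map_zero' := by ext; simp
  map_add' a b := by ext; simp
  map_mul' a b := by
    ext q
    have ha : (a.map (starRingEnd ℂ)).support = a.support := by ext; simp
    have hb : (b.map (starRingEnd ℂ)).support = b.support := by ext; simp
    simp only [HahnSeries.map_coeff, HahnSeries.coeff_mul, map_sum, map_mul]
    refine Finset.sum_congr ?_ fun _ _ => rfl
    simp only [ha, hb]
  commutes' c := by
    rw [algebraMap_hahnSeries_eq]
    ext q
    by_cases h : q = 0
    · simp [h]
    · simp [HahnSeries.coeff_single_of_ne h]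

theorem coeff_conjSeries (φ : HahnSeries ℚ ℂ) (q : ℚ) :
    (conjSeries φ).coeff q = starRingEnd ℂ (φ.coeff q) := rfl

theorem conjSeries_mem_newtonPuiseuxRoots {f : MvPolynomial (Fin 2) ℝ} {γ : HahnSeries ℚ ℂ}
    (hγ : γ ∈ newtonPuiseuxRoots f) : conjSeries γ ∈ newtonPuiseuxRoots f := by
  obtain ⟨⟨N, hN, h⟩, h0⟩ := hγ
  refine ⟨⟨N, hN, fun α hα => h α fun h1 => hα ?_⟩, ?_⟩
  · rw [coeff_conjSeries, h1, map_zero]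
  · have h1 := MvPolynomial.comp_aeval_apply ![γ, yMonomial 1 1] conjSeries f
    have h2 : (fun i => conjSeries (![γ, yMonomial 1 1] i)) =
        ![conjSeries γ, yMonomial 1 1] := by
      funext i
      fin_cases i
      · rfl
      · ext q
        by_cases h : q = 1
        · simp [h, yMonomial, coeff_conjSeries]
        · simp [yMonomial, coeff_conjSeries, HahnSeries.coeff_single_of_ne h]
    rw [h2] at h1
    unfold evalAlong at h0 ⊢
    rw [← h1, h0, map_zero]

/-! ### Initial forms at the contact order -/

open Polynomial in
/-- Extracting the content: a nonzero polynomial is a power of `y` times a polynomial whose reduction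
is nonzero. -/
theorem exists_eq_C_monom_mul (P : puiseuxRing[X]) (hP : P ≠ 0) :
    ∃ (d : ℚ) (hd : 0 ≤ d) (P' : puiseuxRing[X]), P = C (monom d hd 1) * P' ∧
      P'.map residue ≠ 0 := by
  classical
  have key : ∀ i, ∃ (d : ℚ) (hd : 0 ≤ d) (u : puiseuxRing), P.coeff i ≠ 0 →
      P.coeff i = monom d hd 1 * u ∧ residue u ≠ 0 := by
    intro i
    by_cases h : P.coeff i = 0
    · exact ⟨0, le_rfl, 0, fun h' => (h' h).elim⟩
    · obtain ⟨d, hd, u, hu⟩ := exists_eq_monom_mul_residue_ne_zero _ h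
      exact ⟨d, hd, u, fun _ => hu⟩
  choose d hd u hu using key
  obtain ⟨i₀, hi₀, hmin⟩ := P.support.exists_min_image d (support_nonempty.2 hP)
  have hdvd : C (monom (d i₀) (hd i₀) 1) ∣ P := by
    rw [C_dvd_iff_dvd_coeff]
    intro i
    by_cases h : P.coeff i = 0
    · rw [h]; exact dvd_zero _
    · have hle := hmin i (mem_support_iff.2 h)
      rw [(hu i h).1]
      refine Dvd.dvd.mul_right ⟨monom (d i - d i₀) (sub_nonneg.2 hle) 1, ?_⟩ _
      rw [monom_mul_monom]
      simp
  obtain ⟨P', hP'⟩ := hdvd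
  refine ⟨d i₀, hd i₀, P', hP', fun h0 => ?_⟩
  obtain ⟨h1, h2⟩ := hu i₀ (mem_support_iff.1 hi₀)
  apply h2
  have h3 : monom (d i₀) (hd i₀) 1 * u i₀ = monom (d i₀) (hd i₀) 1 * P'.coeff i₀ := by
    rw [← h1]
    conv_lhs => rw [hP']
    rw [coeff_C_mul]
  rw [mul_left_cancel₀ (monom_ne_zero _) h3, ← coeff_map, h0, coeff_zero]

open Polynomial in
/-- The initial form of `f(X + γ(Y), Y)` with respect to the weights `(ρ, 1)`, where `ρ` is the
contact order, vanishes at `0` exactly to the order `mult_γ f`: a larger order would, by the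
Newton–Puiseux theorem, give a root different from `γ` with contact larger than `ρ`. -/
theorem exists_initialForm_at_root {f : MvPolynomial (Fin 2) ℝ} (hf : f ≠ 0) (γ : puiseuxRing)
    (hγ : (γ : HahnSeries ℚ ℂ) ∈ newtonPuiseuxRoots f) {ρ : ℚ} (hρ0 : 0 ≤ ρ)
    (hρ : IsContactOrder (γ : HahnSeries ℚ ℂ) f ρ) :
    ∃ (e : ℚ) (he : 0 ≤ e) (G : puiseuxRing[X]),
      (puiseuxExpand f γ).comp (C (monom ρ hρ0 1) * X) =
        C (monom e he 1) * (X ^ rootMult f γ * G) ∧ residue (G.coeff 0) ≠ 0 := by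
  obtain ⟨G, hG, hndvd⟩ := exists_eq_pow_rootMultiplicity_mul_and_not_dvd (R := puiseuxRing)
    (puiseuxExpand f γ)
    (puiseuxExpand_ne_zero hf γ) (0 : puiseuxRing)
  rw [← rootMult_eq_rootMultiplicity_zero, C_0, sub_zero] at hG
  rw [C_0, sub_zero, X_dvd_iff] at hndvd
  set k := rootMult f γ
  set T := monom ρ hρ0 1 with hT
  have hcomp0 : (G.comp (C T * X)).coeff 0 = G.coeff 0 := by
    rw [comp_C_mul_X_coeff, pow_zero, mul_one]
  obtain ⟨d, hd, G', hG', hres⟩ := exists_eq_C_monom_mul (G.comp (C T * X))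
    (fun h => hndvd (by rw [← hcomp0, h, coeff_zero]))
  refine ⟨k * ρ + d, by positivity, G', ?_, fun h0 => ?_⟩
  · have h1 : monom (k * ρ + d) (by positivity) 1 = T ^ k * monom d hd 1 := by
      rw [hT, monom_pow, monom_mul_monom]
      simp
    rw [hG, mul_comp, hG', pow_comp, X_comp, mul_pow, h1, C_mul, C_pow]
    ring
  · set n := (G'.map residue).natTrailingDegree
    have hn : residue (G'.coeff n) ≠ 0 := by
      rw [← coeff_map]
      exact trailingCoeff_nonzero_iff_nonzero.2 hres
    have hlow : ∀ i < n, residue (G'.coeff i) = 0 := fun i hi => by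
      rw [← coeff_map]
      exact coeff_eq_zero_of_lt_natTrailingDegree hi
    have hn0 : 0 < n := Nat.pos_of_ne_zero fun h => hn (by rw [h, h0])
    -- `γ + y ^ ρ z` is a root that agrees with `γ` up to `y ^ ρ`, which forces `z = 0`
    obtain ⟨z, hz, hroot⟩ := exists_root_residue_eq_zero n hn0 G' hlow hn
    have hGz : G.eval (T * z) = 0 := by
      have h := congrArg (eval z) hG'
      rw [eval_mul (p := C _), hroot, mul_zero] at h
      simpa [eval_comp] using h
    have hcoeff : ∀ q ≤ ρ, ((T * z : puiseuxRing) : HahnSeries ℚ ℂ).coeff q = 0 := by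
      intro q hq
      rw [hT, coeff_monom_mul]
      rcases hq.lt_or_eq with h | h
      · exact coeff_eq_zero_of_neg z (sub_neg.2 h)
      · rw [h, sub_self]
        exact hz
    have hmem : ((γ + T * z : puiseuxRing) : HahnSeries ℚ ℂ) ∈ newtonPuiseuxRoots f := by
      refine ⟨(isPuiseux_iff _).2 ⟨(γ + T * z).2, fun q hq => ?_⟩, ?_⟩
      · have h1 := hcoeff q (hq.le.trans (hρ.one_le hγ))
        have h2 := ((isPuiseux_iff _).1 hγ.1).2 q hq
        change ((γ : HahnSeries ℚ ℂ) + ((T * z : puiseuxRing) : HahnSeries ℚ ℂ)).coeff q = 0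
        rw [HahnSeries.coeff_add, h1, h2, add_zero]
      · refine (coe_eval_puiseuxExpand f γ (T * z)).symm.trans ?_
        rw [hG, eval_mul, hGz, mul_zero]
        rfl
    have heq := hρ.eq_of_coeff_eq hmem fun q hq => by
      change ((γ : HahnSeries ℚ ℂ) + ((T * z : puiseuxRing) : HahnSeries ℚ ℂ)).coeff q = _
      rw [HahnSeries.coeff_add, hcoeff q hq, add_zero]
    have hTz : T * z = 0 := by
      have h1 : γ + T * z = γ := Subtype.ext heq
      exact left_eq_add.1 h1.symm
    rw [hTz, ← coeff_zero_eq_eval_zero] at hGz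
    exact hndvd hGz

open Polynomial in
/-- Replacing `γ` by its truncation shifts the variable of the rescaled expansion by a series
without constant term, so that the initial form stays the same. -/
theorem exists_initialForm_at_truncation {f : MvPolynomial (Fin 2) ℝ} (hf : f ≠ 0)
    (γ τ : puiseuxRing) (hγ : (γ : HahnSeries ℚ ℂ) ∈ newtonPuiseuxRoots f) {ρ : ℚ} (hρ0 : 0 ≤ ρ)
    (hρ : IsContactOrder (γ : HahnSeries ℚ ℂ) f ρ)
    (hτ : ∀ q ≤ ρ, (τ : HahnSeries ℚ ℂ).coeff q = (γ : HahnSeries ℚ ℂ).coeff q) :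
    ∃ (e : ℚ) (he : 0 ≤ e) (F : puiseuxRing[X]) (g : ℂ[X]),
      (puiseuxExpand f τ).comp (C (monom ρ hρ0 1) * X) = C (monom e he 1) * F ∧
      F.map residue = X ^ rootMult f γ * g ∧ g.coeff 0 ≠ 0 := by
  obtain ⟨e, he, G, hG, hG0⟩ := exists_initialForm_at_root hf γ hγ hρ0 hρ
  have hδ : ∀ q ≤ ρ, ((τ - γ : puiseuxRing) : HahnSeries ℚ ℂ).coeff q = 0 := by
    intro q hq
    change ((τ : HahnSeries ℚ ℂ) - (γ : HahnSeries ℚ ℂ)).coeff q = 0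
    rw [HahnSeries.coeff_sub, hτ q hq, sub_self]
  obtain ⟨ε, hε⟩ := exists_eq_monom_mul hρ0 (τ - γ) fun q hq => hδ q hq.le
  have hres : residue ε = 0 := by
    have h := hδ ρ le_rfl
    rw [hε, coeff_monom_mul, sub_self] at h
    exact h
  refine ⟨e, he, taylor ε (X ^ rootMult f γ * G), G.map residue, ?_, ?_, by rwa [coeff_map]⟩
  · have h1 : puiseuxExpand f τ = taylor (τ - γ) (puiseuxExpand f γ) := by
      rw [taylor_puiseuxExpand, add_sub_cancel γ τ]
    have h2 : (puiseuxExpand f τ).comp (C (monom ρ hρ0 1) * X) =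
        taylor ε ((puiseuxExpand f γ).comp (C (monom ρ hρ0 1) * X)) := by
      rw [h1, hε, taylor_apply, taylor_apply, comp_assoc, comp_assoc]
      congr 1
      simp [mul_add]
    rw [h2, hG, taylor_mul, taylor_C]
  · rw [map_taylor_residue, hres, taylor_zero]
    simp

theorem rhoApprox_truncLE (ρ : ℚ) (c : ℝ) (φ : HahnSeries ℚ ℂ) :
    rhoApprox ρ c (truncLE ρ φ) =
      truncLE ρ φ + HahnSeries.single ρ ((c : ℂ) - φ.coeff ρ) := by
  ext q
  simp only [rhoApprox, yMonomial, HahnSeries.coeff_add, HahnSeries.coeff_truncLT, coeff_truncLE]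
  rcases lt_trichotomy q ρ with h | h | h
  · simp [h, h.le, HahnSeries.coeff_single_of_ne h.ne]
  · simp [h]
  · simp [h.not_gt, h.not_ge, HahnSeries.coeff_single_of_ne h.ne']

open Polynomial in
/-- The set consists of the exponents of the monomials in the initial form
`Z ^ k g(Z)`, `g(0) ≠ 0`, of `f(X + γ̃(Y), Y)`, as soon as `c` avoids its finitely many zeros. -/
theorem isLeast_newtonCoeff {f : MvPolynomial (Fin 2) ℝ} (hf : f ≠ 0)
    {γ : HahnSeries ℚ ℂ} (hγ : γ ∈ newtonPuiseuxRoots f) {ρ : ℚ} (hρ : IsContactOrder γ f ρ) :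
    ∀ᶠ c : ℝ in Filter.cofinite,
      IsLeast {i : ℕ | ∃ q : ℚ, newtonCoeff f (truncLE ρ γ) i q ≠ 0 ∧
          (((i : ℚ) * ρ + q : ℚ) : WithTop ℚ) =
            (evalAlong f (rhoApprox ρ c (truncLE ρ γ))).orderTop}
        (rootMult f γ) := by
  have hρ0 : 0 ≤ ρ := zero_le_one.trans (hρ.one_le hγ)
  have hmem := ((isPuiseux_iff γ).1 hγ.1).1
  obtain ⟨e, he, F, g, hF, hFg, hg⟩ := exists_initialForm_at_truncation hf ⟨γ, hmem⟩
    ⟨truncLE ρ γ, truncLE_mem_puiseuxRing ρ hmem⟩ hγ hρ0 hρ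
    (fun q hq => by change (truncLE ρ γ).coeff q = γ.coeff q; rw [coeff_truncLE, if_pos hq])
  change F.map residue = X ^ rootMult f γ * g at hFg
  set τ : puiseuxRing := ⟨truncLE ρ γ, truncLE_mem_puiseuxRing ρ hmem⟩ with hτ
  have hF0 : F.map residue ≠ 0 := by
    rw [hFg]
    refine mul_ne_zero (pow_ne_zero _ X_ne_zero) ?_
    rintro rfl
    exact hg (coeff_zero 0)
  have hfin : {c : ℝ | (F.map residue).eval ((c : ℂ) - γ.coeff ρ) = 0}.Finite := by
    have h := (F.map residue).roots.toFinset.finite_toSet.preimage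
      (f := fun c : ℝ => (c : ℂ) - γ.coeff ρ)
      (fun a _ b _ h => Complex.ofReal_injective (sub_left_injective h))
    refine h.subset fun c hc => ?_
    simpa [hF0] using hc
  filter_upwards [hfin.compl_mem_cofinite] with c hc
  -- away from the zeros of the initial form, the order of `f` along the `ρ`-approximation is the weight of the initial form
  have hord : (evalAlong f (rhoApprox ρ c (truncLE ρ γ))).orderTop = (e : WithTop ℚ) := by
    -- the `ρ`-approximation is the value of the rescaled variable at the constant `c - c_ρ`
    set κ := monom 0 le_rfl ((c : ℂ) - γ.coeff ρ) with hκ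
    have h1 : rhoApprox ρ c (truncLE ρ γ) =
        (τ : HahnSeries ℚ ℂ) + ((monom ρ hρ0 1 * κ : puiseuxRing) : HahnSeries ℚ ℂ) := by
      rw [rhoApprox_truncLE, hκ, monom_mul_monom]
      simp [hτ]
    have h2 : (puiseuxExpand f τ).eval (monom ρ hρ0 1 * κ) = monom e he 1 * F.eval κ := by
      have h := congrArg (eval κ) hF
      simpa [eval_comp] using h
    rw [h1, ← coe_eval_puiseuxExpand, h2]
    refine orderTop_monom_mul he ?_
    rw [← eval_map_apply, hκ, residue_monom_zero]
    exact hc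
  have hset : ∀ i : ℕ, (∃ q : ℚ, newtonCoeff f (truncLE ρ γ) i q ≠ 0 ∧
      (((i : ℚ) * ρ + q : ℚ) : WithTop ℚ) =
        (evalAlong f (rhoApprox ρ c (truncLE ρ γ))).orderTop) ↔ (F.map residue).coeff i ≠ 0 := by
    intro i
    have h1 : monom (i * ρ) (by positivity) 1 * (puiseuxExpand f τ).coeff i =
        monom e he 1 * F.coeff i := by
      have h := congrArg (fun P : puiseuxRing[X] => P.coeff i) hF
      simp only [comp_C_mul_X_coeff, coeff_C_mul, monom_pow] at h
      rw [← h, mul_comm]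
    have h2 : newtonCoeff f (truncLE ρ γ) i (e - i * ρ) = (F.map residue).coeff i := by
      have h := congrArg (fun φ : puiseuxRing => (φ : HahnSeries ℚ ℂ).coeff e) h1
      simp only [coeff_monom_mul, sub_self] at h
      rw [coeff_map, residue_apply, ← h, ← coeff_expandAlong]
      rfl
    rw [hord, ← h2]
    constructor
    · rintro ⟨q, hq, h⟩
      rwa [← WithTop.coe_inj.1 h, add_sub_cancel_left]
    · exact fun h => ⟨_, h, by rw [add_sub_cancel]⟩
  constructor
  · refine (hset _).2 ?_
    rw [hFg, coeff_X_pow_mul', if_pos le_rfl, Nat.sub_self]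
    exact hg
  · intro i hi
    by_contra! hlt
    refine (hset i).1 hi ?_
    rw [hFg, coeff_X_pow_mul', if_neg (not_le.2 hlt)]

theorem mainTheorem4 (f : MvPolynomial (Fin 2) ℝ) (hf : XRegular f)
    (γ : HahnSeries ℚ ℂ) (hγ : γ ∈ newtonPuiseuxRoots f)
    (hother : ∃ γ' ∈ newtonPuiseuxRoots f, γ' ≠ γ) :
    ∃ ρ : ℚ, IsContactOrder γ f ρ ∧
      (IsRealSeries (truncLE ρ γ) → IsRealSeries γ) ∧
      (∀ᶠ c : ℝ in Filter.cofinite,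
        IsLeast {i : ℕ | ∃ q : ℚ, newtonCoeff f (truncLE ρ γ) i q ≠ 0 ∧
            (((i : ℚ) * ρ + q : ℚ) : WithTop ℚ) =
              (evalAlong f (rhoApprox ρ c (truncLE ρ γ))).orderTop}
          (rootMult f γ)) ∧
      (∀ g h : MvPolynomial (Fin 2) ℝ, XRegular g → IsGCDOf h f g →
        IsRootMod (truncLE ρ γ) ρ h → γ ∈ newtonPuiseuxRoots g) := by
  obtain ⟨ρ, hρ⟩ := exists_isContactOrder hf.ne_zero hother
  refine ⟨ρ, hρ, fun hreal α => ?_, isLeast_newtonCoeff hf.ne_zero hγ hρ, ?_⟩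
  · have hconj := hρ.eq_of_coeff_eq (conjSeries_mem_newtonPuiseuxRoots hγ) fun q hq => by
      have h := hreal q
      rw [coeff_truncLE, if_pos hq] at h
      rw [coeff_conjSeries]
      exact Complex.conj_eq_iff_im.2 h
    rw [← Complex.conj_eq_iff_im, ← coeff_conjSeries, hconj]
  · rintro g h - ⟨hhf, hhg, -⟩ ⟨ξ, hξ, hord⟩
    rw [lt_orderTop_iff_forall_coeff] at hord
    have hξγ := hρ.eq_of_coeff_eq (newtonPuiseuxRoots_subset_of_dvd hhf hξ) fun q hq => by
      have h := hord q hq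
      rw [HahnSeries.coeff_sub, coeff_truncLE, if_pos hq] at h
      exact (sub_eq_zero.1 h).symm
    rw [← hξγ]
    exact newtonPuiseuxRoots_subset_of_dvd hhg hξ
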